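/- For a Boolean function $f:\{0,1\}^n\to\{0,1\}$ and $\omega\in\{0,1\}^n$ let $W_f(\omega)=\sum_{x\in\{0,1\}^n}(-1)^{f(x)\oplus x\cdot\omega}$ be its Walsh transform, where $x\cdot\omega=x_1\omega_1\oplus\cdots\oplus x_n\omega_n$. The function $f$ is given as an oracle (black box), which returns $f(x)$ for a queried $x\in\{0,1\}^n$. A $\mathrm{P}^{\mathrm{NP}}$ algorithm relative to an oracle $A$ is a deterministic polynomial-time machine with an output, which may query a language in $\mathrm{NP}^A$ (given by a fixed polynomial-time verifier with oracle access to $A$). (1) SAT is polynomial-time Turing reducible to computing $W_f(0)$ from a Boolean function $f$ given as an oracle; that is, some deterministic polynomial-time machine decides the satisfiability of formulas in conjunctive normal form by calls to a solver which returns $W_f(0)$, where the functions $f$ that it passes to the solver can be evaluated in polynomial time. (2) Computing $W_f(0)$ is outside $\mathrm{P}^{\mathrm{NP}}$ relative to the oracle: no $\mathrm{P}^{\mathrm{NP}}$ algorithm, given $1^n$ and relative to the oracle $f$, outputs $W_f(0)$ for all $n$ and all Boolean functions $f$ of $n$ variables. Moreover there is a single oracle $A:\{0,1\}^*\to\{0,1\}$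 such that no $\mathrm{P}^{\mathrm{NP}}$ algorithm relative to $A$ computes $W_{A_n}(0)$ from $1^n$ for all $n$, where $A_n$ is the restriction of $A$ to $\{0,1\}^n$. (3) For given nonzero $\omega$, computing $W_f(\omega)$ is outside $\mathrm{P}^{\mathrm{NP}}$ relative to the oracle: for every choice of nonzero $\omega_n\in\{0,1\}^n$ ($n\ge 1$), no $\mathrm{P}^{\mathrm{NP}}$ algorithm, given $\omega_n$ and relative to the oracle $f$, outputs $W_f(\omega_n)$ for all $n\ge1$ and all Boolean functions $f$ of $n$ variables; moreover there is a single oracle $A$ (depending on the sequence $(\omega_n)$) such that no $\mathrm{P}^{\mathrm{NP}}$ algorithm relative to $A$ computes $W_{A_n}(\omega_n)$ from $\omega_n$ for all $n\ge1$. -/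

import Mathlib

namespace WalshOracle

/-! ### Boolean functions and the Walsh transform -/

/-- Boolean functions of `n` variables. -/
abbrev BoolFun (n : ℕ) : Type := (Fin n → Bool) → Bool

/-- The inner product `x₁ω₁ ⊕ ⋯ ⊕ xₙωₙ`, the parity of the number of `i` with `xᵢ = ωᵢ = 1`. -/
def dot {n : ℕ} (x ω : Fin n → Bool) : Bool :=
  decide (Odd (Finset.univ.filter fun i => x i && ω i).card)

/-- The Walsh transform `W_f(ω) = ∑ₓ (-1)^(f(x) ⊕ x·ω)`. -/
def walsh {n : ℕ} (f : BoolFun n) (ω : Fin n → Bool) : ℤ :=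
  ∑ x : Fin n → Bool, (-1) ^ (xor (f x) (dot x ω)).toNat

/-- The point `0` of `{0,1}ⁿ`. -/
def zeroPt (n : ℕ) : Fin n → Bool := fun _ => false

/-! ### Deterministic oracle machines with a step count

The machine has a finite control and finitely many pushdown stacks over `{0,1}` (the stacks that
its program mentions); a Turing tape is a pair of such stacks, so up to constant factors in the
running time these are the multitape oracle Turing machines. One instruction is one step. -/

/-- Instructions; the natural numbers `next`, … are the addresses of the following instruction. -/
inductive Instr : Type
  /-- push the bit `b` on stack `s` -/
  | push (s : ℕ) (b : Bool) (next : ℕ)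
  /-- remove the top bit of stack `s`, and branch on its value, or on the stack being empty -/
  | pop (s : ℕ) (onFalse onTrue onEmpty : ℕ)
  /-- oracle call: replace the content of stack `s` by the answer of the oracle to it -/
  | ask (s : ℕ) (next : ℕ)

/-- A program; execution starts at address `0` and halts on leaving the range of addresses. -/
abbrev Program : Type := List Instr

/-- Machine configurations. -/
structure Config : Type where
  /-- address of the current instruction -/
  pc : ℕ
  /-- contents of the stacks, top first -/
  stack : ℕ → List Bool

/-- Effect of one instruction, with oracle `O`. -/
def Instr.exec (O : List Bool → List Bool) (c : Config) : Instr → Config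
  | .push s b next => ⟨next, Function.update c.stack s (b :: c.stack s)⟩
  | .pop s onFalse onTrue onEmpty =>
    match c.stack s with
    | [] => ⟨onEmpty, c.stack⟩
    | false :: l => ⟨onFalse, Function.update c.stack s l⟩
    | true :: l => ⟨onTrue, Function.update c.stack s l⟩
  | .ask s next => ⟨next, Function.update c.stack s (O (c.stack s))⟩

/-- One step of the machine; halted configurations do not change any more. -/
def Program.step (P : Program) (O : List Bool → List Bool) (c : Config) : Config :=
  match P[c.pc]? with
  | none => c
  | some i => i.exec O c

/-- Initial configuration: the input `x` on stack `0`, a second input `y` (such as a certificate)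
on stack `1`, all other stacks empty. -/
def start (x y : List Bool) : Config :=
  ⟨0, fun s => if s = 0 then x else if s = 1 then y else []⟩

/-- The configuration after `t` steps on the inputs `x`, `y`. -/
def Program.runFor (P : Program) (O : List Bool → List Bool) (x y : List Bool) (t : ℕ) : Config :=
  (P.step O)^[t] (start x y)

/-- With oracle `O`, on the inputs `x`, `y`, the program halts within `t` steps, with output `w`
(the content of stack `0`). -/
def Program.OutputsWithin (P : Program) (O : List Bool → List Bool) (x y w : List Bool) (t : ℕ) :
    Prop :=
  P.length ≤ (P.runFor O x y t).pc ∧ (P.runFor O x y t).stack 0 = w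

/-- With oracle `O`, on the inputs `x`, `y`, the program halts within `t` steps and accepts
(the top bit of stack `0` is `1`). -/
def Program.AcceptsWithin (P : Program) (O : List Bool → List Bool) (x y : List Bool) (t : ℕ) :
    Prop :=
  P.length ≤ (P.runFor O x y t).pc ∧ ((P.runFor O x y t).stack 0).head? = some true

/-- The oracle of a Boolean function on bit strings, with one-bit answers. -/
def boolOracle (A : List Bool → Bool) : List Bool → List Bool := fun z => [A z]

/-- The membership oracle of a language. -/
noncomputable def langOracle (L : Set (List Bool)) : List Bool → List Bool :=
  open Classical in fun z => [decide (z ∈ L)]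

/-- The oracle of a machine that makes no use of an oracle: all answers are empty. -/
def noOracle : List Bool → List Bool := fun _ => []

/-! ### NP and (functional) P^NP relative to an oracle -/

/-- The language in `NP^A` given by a polynomial-time oracle verifier `V` and a polynomial `p`: the
strings `x` having a certificate `y` with `|y| ≤ p(|x|)` such that `V`, with oracle `A`, accepts
`(x, y)` within `p(|x|)` steps. The languages in `NP^A` are those of this form. -/
def npLang (V : Program) (p : Polynomial ℕ) (A : List Bool → Bool) : Set (List Bool) :=
  {x | ∃ y : List Bool, y.length ≤ p.eval x.length ∧
    V.AcceptsWithin (boolOracle A) x y (p.eval x.length)}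

/-- A `P^NP` algorithm relative to an oracle `A` that is not fixed yet: a deterministic machine, with
a polynomial bound on its running time, whose queries go to the `NP^A` language of a verifier.
(As `A` itself is in `NP^A`, and `NP^A` is closed under disjoint unions, this includes queries
to `A`.) -/
structure PNPAlgorithm : Type where
  /-- the deterministic machine -/
  machine : Program
  /-- its running time -/
  time : Polynomial ℕ
  /-- the verifier of the `NP` language that is queried -/
  verifier : Program
  /-- certificate length and running time of the verifier -/
  bound : Polynomial ℕ

/-- On input `x`, with the oracle `A`, the algorithm outputs `w` within its time bound. -/
def PNPAlgorithm.Computes (P : PNPAlgorithm) (A : List Bool → Bool) (x w : List Bool) : Prop :=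
  P.machine.OutputsWithin (langOracle (npLang P.verifier P.bound A)) x [] w (P.time.eval x.length)

/-! ### Input and output -/

/-- `n` in unary. -/
def unary (n : ℕ) : List Bool := List.replicate n true

/-- Integers as output: a sign bit, then the binary digits of the absolute value, least
significant digit first. -/
def encodeInt (a : ℤ) : List Bool := decide (a < 0) :: a.natAbs.bits

/-- A Boolean function of `n` variables as an oracle: it is evaluated on strings of length `n`;
other queries carry no information (the answer is `0`). -/
def blackBox {n : ℕ} (f : BoolFun n) : List Bool → Bool :=
  fun z => if h : z.length = n then f (fun i => z.get (i.cast h.symm)) else false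

/-- The Boolean function of `n` variables that an oracle gives on the strings of length `n`. -/
def slice (A : List Bool → Bool) (n : ℕ) : BoolFun n := fun x => A (List.ofFn x)

/-! ### Polynomial-time Turing reductions to problems about Boolean functions given as oracles -/

/-- The oracle that solves instances `(n, f)` of a problem `Φ` on Boolean functions `f` of `n`
variables. In a reduction the instance has to be supplied by the reduction: the query `z` contains
`n` in unary (as the number of leading `1`s), and `f` is the function whose value at `x` is found by
running the evaluation program `E` on `(z, x)` for at most `p(|z| + |x|)` steps. Thus `f` is available
to a solver of `Φ` as a black box that is simulated in polynomial time. -/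
noncomputable def solverOracle (Φ : (n : ℕ) → BoolFun n → ℤ) (E : Program) (p : Polynomial ℕ) :
    List Bool → List Bool :=
  open Classical in fun z => encodeInt (Φ (z.takeWhile id).length (fun x =>
    decide (E.AcceptsWithin noOracle z (List.ofFn x)
      (p.eval (z.length + (z.takeWhile id).length)))))

/-- The decision problem `S` (with instances encoded by `enc`) is polynomial-time Turing reducible to
the computation of `Φ(f)` from Boolean functions `f` given as oracles: a polynomial-time machine
decides `S` by calls to a solver of `Φ`, where the instances of `Φ` that it poses are functions which
can be evaluated in polynomial time. -/
def TuringReducible {α : Type} (enc : α → List Bool) (S : α → Prop)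
    (Φ : (n : ℕ) → BoolFun n → ℤ) : Prop :=
  open Classical in
  ∃ (M : Program) (q : Polynomial ℕ) (E : Program) (p : Polynomial ℕ), ∀ a : α,
    M.OutputsWithin (solverOracle Φ E p) (enc a) [] [decide (S a)] (q.eval (enc a).length)

/-! ### SAT -/

/-- Formulas in conjunctive normal form: the number `n` of variables and the list of clauses, each
clause a list of literals; the literal `(i, true)` is the variable `i`, and `(i, false)` is its
negation. -/
structure CNF : Type where
  /-- number of variables -/
  vars : ℕ
  /-- clauses -/
  clauses : List (List (Fin vars × Bool))

/-- The value of a formula under an assignment. -/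
def CNF.eval (φ : CNF) (x : Fin φ.vars → Bool) : Bool :=
  φ.clauses.all fun c => c.any fun l => x l.1 == l.2

/-- Satisfiability. -/
def CNF.Satisfiable (φ : CNF) : Prop := ∃ x, φ.eval x = true

/-- A formula as a bit string: the number of variables in unary, then the clauses; every clause and
every literal is announced by a `1`, every list is closed by a `0`, and a literal is the index of
its variable in unary, closed by a `0`, and its sign. -/
def CNF.encode (φ : CNF) : List Bool :=
  unary φ.vars ++ [false] ++
    (φ.clauses.flatMap fun c =>
      [true] ++ (c.flatMap fun l => [true] ++ unary l.1 ++ [false, l.2]) ++ [false]) ++ [false]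

end WalshOracle

open WalshOracle

namespace WalshOracle

/-! ### Elementary facts about machines -/

/-! Reduction: add a variable `x 0` to the formula `φ` and put `f = x 0 ∨ φ`. In `W_f(0)` the half
`x 0 = 1` cancels the half `x 0 = 0` except at satisfying assignments, each of which leaves `-2`
(`walsh_or_zeroPt`). So `W_f(0) < 0` exactly when `φ` is satisfiable, and one solver call whose
answer starts with the sign bit suffices. The rest of this half verifies two explicit programs,
`evalProgram` for `f` and `signProgram` for the call.

Lower bounds: an accepting run of the verifier reads polynomially many oracle values, so a positive
NP answer is secured by fixing these. An adversary answers yes whenever some oracle consistent with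
the values fixed so far allows it, and fixes the witnessing values; otherwise the answer is no for
every consistent oracle and costs nothing. Hence polynomially many values determine the whole run
(`PNPAlgorithm.exists_forced_run`). For large `n` a point of `{0,1}ⁿ` stays free; flipping `f` there
changes `W_f(ω)` by `±2`, for any `ω`, but not the output (`PNPAlgorithm.exists_fails`). For a
single oracle, failure of a given algorithm can be forced by finitely many values after any finite
prescription, and there are countably many algorithms, so Baire category applies
(`exists_oracle_forall`). -/

theorem Program.step_of_length_le {P : Program} (O : List Bool → List Bool) {c : Config}
    (h : P.length ≤ c.pc) : P.step O c = c := by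
  simp [Program.step, List.getElem?_eq_none h]

/-- From `c` the program reaches `d` in at most `n` steps. -/
def Program.Reaches (P : Program) (O : List Bool → List Bool) (n : ℕ) (c d : Config) : Prop :=
  ∃ t ≤ n, (P.step O)^[t] c = d

namespace Program.Reaches

variable {P : Program} {O : List Bool → List Bool} {m n : ℕ} {c d e : Config}

theorem refl (P : Program) (O : List Bool → List Bool) (n : ℕ) (c : Config) :
    P.Reaches O n c c := ⟨0, Nat.zero_le _, rfl⟩

theorem mono (h : P.Reaches O m c d) (hmn : m ≤ n) : P.Reaches O n c d :=
  let ⟨t, ht, e⟩ := h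
  ⟨t, ht.trans hmn, e⟩

theorem trans (h₁ : P.Reaches O m c d) (h₂ : P.Reaches O n d e) : P.Reaches O (m + n) c e := by
  obtain ⟨t, ht, rfl⟩ := h₁
  obtain ⟨s, hs, rfl⟩ := h₂
  exact ⟨s + t, by omega, Function.iterate_add_apply ..⟩

theorem head (h₁ : P.step O c = d) (h₂ : P.Reaches O n d e) : P.Reaches O (n + 1) c e := by
  obtain ⟨s, hs, rfl⟩ := h₂
  exact ⟨s + 1, by omega, by rw [Function.iterate_succ_apply, h₁]⟩

theorem runFor_eq {x y : List Bool} (h : P.Reaches O n (start x y) d) (hd : P.length ≤ d.pc) :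
    P.runFor O x y n = d := by
  obtain ⟨t, ht, e⟩ := h
  obtain ⟨s, rfl⟩ := Nat.exists_eq_add_of_le' ht
  rw [Program.runFor, Function.iterate_add_apply, e]
  exact Function.iterate_fixed (step_of_length_le O hd) s

end Program.Reaches

/-- The stacks with given contents of the stacks `0`, `1`, `2` and `3`, all others empty. -/
def fourStacks (a b c d : List Bool) : ℕ → List Bool
  | 0 => a
  | 1 => b
  | 2 => c
  | 3 => d
  | _ => []

section layout
variable (a b c d l : List Bool)

@[simp] theorem fourStacks_zero : fourStacks a b c d 0 = a := rfl
@[simp] theorem fourStacks_one : fourStacks a b c d 1 = b := rfl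
@[simp] theorem fourStacks_two : fourStacks a b c d 2 = c := rfl
@[simp] theorem fourStacks_three : fourStacks a b c d 3 = d := rfl

@[simp] theorem update_fourStacks_zero :
    Function.update (fourStacks a b c d) 0 l = fourStacks l b c d := by
  funext s; rcases s with _ | _ | _ | _ | s <;> simp [fourStacks, Function.update]

@[simp] theorem update_fourStacks_one :
    Function.update (fourStacks a b c d) 1 l = fourStacks a l c d := by
  funext s; rcases s with _ | _ | _ | _ | s <;> simp [fourStacks, Function.update]

@[simp] theorem update_fourStacks_two :
    Function.update (fourStacks a b c d) 2 l = fourStacks a b l d := by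
  funext s; rcases s with _ | _ | _ | _ | s <;> simp [fourStacks, Function.update]

@[simp] theorem update_fourStacks_three :
    Function.update (fourStacks a b c d) 3 l = fourStacks a b c l := by
  funext s; rcases s with _ | _ | _ | _ | s <;> simp [fourStacks, Function.update]

theorem start_eq_fourStacks : start a b = ⟨0, fourStacks a b [] []⟩ := by
  simp only [start, Config.mk.injEq, true_and]
  funext s; rcases s with _ | _ | _ | _ | s <;> simp [fourStacks]

end layout

/-! ### Evaluating a formula in conjunctive normal form -/

/-- On a first input `1` followed by the code of a formula and a second input `b` followed by an
assignment, this program accepts if `b = 1` or the assignment satisfies the formula. Stack `2` holds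
the part of the assignment that has been passed in looking up a variable, and stack `3` holds one
bit for each true literal found in the current clause. -/
def evalProgram : Program :=
  -- Addresses: 0–2 drop the leading `1`, test `b` and skip the number of variables; 3 opens a
  -- clause or ends the formula, 4 opens a literal or ends the clause; 5–6 test and clear the marks;
  -- 7–10 walk to the variable; 11–17 compare it with the sign and put it back; 18–20 rewind the
  -- assignment; 21 and 22 write the verdict.
  [.pop 0 1 1 1,
   .pop 1 2 21 2,
   .pop 0 3 2 3,
   .pop 0 21 4 21,
   .pop 0 5 7 5,
   .pop 3 6 6 22,
   .pop 3 6 6 3,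
   .pop 0 11 8 11,
   .pop 1 9 10 7,
   .push 2 false 7,
   .push 2 true 7,
   .pop 0 12 13 12,
   .pop 1 14 17 18,
   .pop 1 16 15 18,
   .push 3 true 16,
   .push 3 true 17,
   .push 1 false 18,
   .push 1 true 18,
   .pop 2 19 20 4,
   .push 1 false 18,
   .push 1 true 18,
   .push 0 true 23,
   .push 0 false 23]

theorem length_evalProgram : evalProgram.length = 23 := rfl

section evalProgram
open Program.Reaches

variable (O : List Bool → List Bool)

theorem evalProgram_skip (n : ℕ) (r b c d : List Bool) :
    evalProgram.Reaches O (n + 1) ⟨2, fourStacks (unary n ++ false :: r) b c d⟩ ⟨3, fourStacks r b c d⟩ := by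
  induction n with
  | zero => exact head (by simp [Program.step, evalProgram, Instr.exec, unary]) (refl ..)
  | succ n ih =>
    exact head (by simp [Program.step, evalProgram, Instr.exec, unary, List.replicate_succ]) ih

theorem evalProgram_clear (k : ℕ) (a b c : List Bool) :
    evalProgram.Reaches O (k + 1) ⟨6, fourStacks a b c (List.replicate k true)⟩ ⟨3, fourStacks a b c []⟩ := by
  induction k with
  | zero => exact head (by simp [Program.step, evalProgram, Instr.exec]) (refl ..)
  | succ n ih =>
    exact head (by simp [Program.step, evalProgram, Instr.exec, List.replicate_succ]) ih

/-- Each variable passed costs three steps: a unary digit, a pop from stack `1`, a push on stack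
`2`, which therefore holds the prefix reversed. -/
theorem evalProgram_forward (u r v w d : List Bool) :
    evalProgram.Reaches O (3 * u.length + 1) ⟨7, fourStacks (unary u.length ++ false :: r) (u ++ v) w d⟩
      ⟨11, fourStacks r v (u.reverse ++ w) d⟩ := by
  induction u generalizing w with
  | nil => exact head (by simp [Program.step, evalProgram, Instr.exec, unary]) (refl ..)
  | cons b u ih =>
    have := ih (b :: w)
    refine mono (m := 3 * u.length + 1 + 1 + 1 + 1) ?_ (by simp; omega)
    refine head (d := ⟨8, fourStacks (unary u.length ++ false :: r) (b :: u ++ v) w d⟩)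
      (by simp [Program.step, evalProgram, Instr.exec, unary, List.replicate_succ]) ?_
    cases b
    · refine head (d := ⟨9, fourStacks (unary u.length ++ false :: r) (u ++ v) w d⟩)
        (by simp [Program.step, evalProgram, Instr.exec]) ?_
      exact head (by simp [Program.step, evalProgram, Instr.exec]; rfl) (by simpa using this)
    · refine head (d := ⟨10, fourStacks (unary u.length ++ false :: r) (u ++ v) w d⟩)
        (by simp [Program.step, evalProgram, Instr.exec]) ?_
      exact head (by simp [Program.step, evalProgram, Instr.exec]; rfl) (by simpa using this)

theorem evalProgram_back (u a v d : List Bool) :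
    evalProgram.Reaches O (2 * u.length + 1) ⟨18, fourStacks a v u d⟩ ⟨4, fourStacks a (u.reverse ++ v) [] d⟩ := by
  induction u generalizing v with
  | nil => exact head (by simp [Program.step, evalProgram, Instr.exec]) (refl ..)
  | cons b u ih =>
    have := ih (b :: v)
    refine mono (m := 2 * u.length + 1 + 1 + 1) ?_ (by simp; omega)
    cases b
    · refine head (d := ⟨19, fourStacks a v u d⟩) (by simp [Program.step, evalProgram, Instr.exec]) ?_
      exact head (by simp [Program.step, evalProgram, Instr.exec]; rfl) (by simpa using this)
    · refine head (d := ⟨20, fourStacks a v u d⟩) (by simp [Program.step, evalProgram, Instr.exec]) ?_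
      exact head (by simp [Program.step, evalProgram, Instr.exec]; rfl) (by simpa using this)

theorem evalProgram_compare (b s : Bool) (r v w : List Bool) (k : ℕ) :
    evalProgram.Reaches O 4 ⟨11, fourStacks (s :: r) (b :: v) w (List.replicate k true)⟩
      ⟨18, fourStacks r (b :: v) w (List.replicate (k + (b == s).toNat) true)⟩ := by
  cases b <;> cases s
  · exact ⟨4, le_rfl, by
      simp [Program.step, evalProgram, Instr.exec, List.replicate_succ]⟩
  · exact ⟨3, by omega, by
      simp [Program.step, evalProgram, Instr.exec]⟩
  · exact ⟨3, by omega, by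
      simp [Program.step, evalProgram, Instr.exec]⟩
  · exact ⟨4, le_rfl, by
      simp [Program.step, evalProgram, Instr.exec, List.replicate_succ]⟩

/-- The code of a literal. -/
def encodeLiteral {n : ℕ} (l : Fin n × Bool) : List Bool := [true] ++ unary l.1 ++ [false, l.2]

/-- The code of a clause. -/
def encodeClause {n : ℕ} (c : List (Fin n × Bool)) : List Bool :=
  [true] ++ c.flatMap encodeLiteral ++ [false]

variable {n : ℕ} (x : Fin n → Bool)

theorem evalProgram_literal (l : Fin n × Bool) (r : List Bool) (k : ℕ) :
    evalProgram.Reaches O (5 * (encodeLiteral l).length)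
      ⟨4, fourStacks (encodeLiteral l ++ r) (List.ofFn x) [] (List.replicate k true)⟩
      ⟨4, fourStacks r (List.ofFn x) [] (List.replicate (k + (x l.1 == l.2).toNat) true)⟩ := by
  obtain ⟨i, s⟩ := l
  obtain ⟨u, v, hu, hv⟩ : ∃ u v : List Bool, u.length = i ∧ List.ofFn x = u ++ x i :: v := by
    refine ⟨(List.ofFn x).take i, (List.ofFn x).drop (i + 1), by simp, ?_⟩
    have : x i = (List.ofFn x)[(i : ℕ)]'(by simp) := by simp
    rw [this, List.cons_getElem_drop_succ, List.take_append_drop]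
  rw [hv]
  -- One step opens the literal; the others walk forward, compare and rewind. The total `5 *
  -- u.length + 7` is covered because the code of the literal has length `u.length + 3`.
  refine mono (m := (3 * u.length + 1) + 4 + (2 * u.length + 1) + 1) ?_
    (by simp [encodeLiteral, unary]; omega)
  refine head (d := ⟨7, fourStacks (unary u.length ++ false :: s :: r) (u ++ x i :: v) []
    (List.replicate k true)⟩) (by
      simp [Program.step, evalProgram, Instr.exec, encodeLiteral, unary, hu]) ?_
  refine trans (trans (evalProgram_forward ..) (evalProgram_compare ..)) ?_
  have := evalProgram_back O u.reverse r (x i :: v)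
    (List.replicate (k + (x i == s).toNat) true)
  simpa using this

theorem evalProgram_literals (c : List (Fin n × Bool)) (r : List Bool) (k : ℕ) :
    evalProgram.Reaches O (5 * (c.flatMap encodeLiteral).length + 1)
      ⟨4, fourStacks (c.flatMap encodeLiteral ++ false :: r) (List.ofFn x) [] (List.replicate k true)⟩
      ⟨5, fourStacks r (List.ofFn x) []
        (List.replicate (k + c.countP fun l => x l.1 == l.2) true)⟩ := by
  induction c generalizing k with
  | nil => exact head (by simp [Program.step, evalProgram, Instr.exec]) (refl ..)
  | cons l c ih =>
    have h := trans (evalProgram_literal O x l (c.flatMap encodeLiteral ++ false :: r) k) (ih _)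
    have e : k + (x l.1 == l.2).toNat + c.countP (fun l => x l.1 == l.2) =
        k + (l :: c).countP fun l => x l.1 == l.2 := by
      rw [List.countP_cons]; cases x l.1 == l.2
      · simp
      · simp; omega
    rw [e] at h
    refine mono (m := 5 * (encodeLiteral l).length + (5 * (c.flatMap encodeLiteral).length + 1))
      ?_ (by simp; omega)
    simpa using h

theorem length_le_length_flatMap_encodeLiteral (c : List (Fin n × Bool)) :
    c.length ≤ (c.flatMap encodeLiteral).length := by
  induction c with
  | nil => simp
  | cons l c ih =>
    simp only [List.flatMap_cons, List.length_append, List.length_cons]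
    have : 1 ≤ (encodeLiteral l).length := by simp [encodeLiteral]
    omega

/-- Five steps per code bit read the literals; the sixth pays for clearing the marks, of which there
are at most as many as literals. -/
theorem evalProgram_clause (c : List (Fin n × Bool)) (r : List Bool) :
    evalProgram.Reaches O (6 * (encodeClause c).length)
      ⟨3, fourStacks (encodeClause c ++ r) (List.ofFn x) [] []⟩
      ⟨if c.any fun l => x l.1 == l.2 then 3 else 22, fourStacks r (List.ofFn x) [] []⟩ := by
  have hlen := length_le_length_flatMap_encodeLiteral c
  have hcount : (c.countP fun l => x l.1 == l.2) ≤ c.length := List.countP_le_length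
  have h := evalProgram_literals O x c r 0
  refine mono (m := (5 * (c.flatMap encodeLiteral).length + 1) +
    ((c.countP fun l => x l.1 == l.2) + 1) + 1) ?_ (by
      simp only [encodeClause, List.length_append, List.length_cons, List.length_nil]; omega)
  refine head (by simp [Program.step, evalProgram, Instr.exec, encodeClause]; rfl) ?_
  refine trans h ?_
  rw [Nat.zero_add]
  by_cases hc : c.any fun l => x l.1 == l.2
  · obtain ⟨k, hk⟩ : ∃ k, (c.countP fun l => x l.1 == l.2) = k + 1 :=
      Nat.exists_eq_succ_of_ne_zero (by
        rw [← Nat.pos_iff_ne_zero, List.countP_pos_iff]; simpa using hc)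
    rw [if_pos hc, hk]
    exact head (by simp [Program.step, evalProgram, Instr.exec, List.replicate_succ])
      (evalProgram_clear ..)
  · have hk : (c.countP fun l => x l.1 == l.2) = 0 := by
      rw [List.countP_eq_zero]; exact fun l hl h' => hc (List.any_eq_true.2 ⟨l, hl, h'⟩)
    rw [if_neg hc, hk]
    exact head (by simp [Program.step, evalProgram, Instr.exec]) (refl ..)

/-- The tail `a` is the unread code that lies below the verdict when a clause fails; acceptance
looks only at the top bit. -/
theorem evalProgram_clauses (cs : List (List (Fin n × Bool))) :
    ∃ a, evalProgram.Reaches O (6 * (cs.flatMap encodeClause).length + 2)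
      ⟨3, fourStacks (cs.flatMap encodeClause ++ [false]) (List.ofFn x) [] []⟩
      ⟨23, fourStacks ((cs.all fun c => c.any fun l => x l.1 == l.2) :: a) (List.ofFn x) [] []⟩ := by
  induction cs with
  | nil =>
    exact ⟨[], 2, by simp, by simp [Program.step, evalProgram, Instr.exec]⟩
  | cons c cs ih =>
    have h := evalProgram_clause O x c (cs.flatMap encodeClause ++ [false])
    simp only [List.flatMap_cons, List.append_assoc, List.all_cons, List.length_append]
    by_cases hc : c.any fun l => x l.1 == l.2
    · rw [if_pos hc] at h
      obtain ⟨a, ha⟩ := ih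
      exact ⟨a, mono (by rw [hc, Bool.true_and]; exact trans h ha) (by omega)⟩
    · rw [if_neg hc] at h
      simp only [Bool.not_eq_true] at hc
      refine ⟨cs.flatMap encodeClause ++ [false], mono (n := 6 * ((encodeClause c).length + (cs.flatMap encodeClause).length) + 2)
        (trans h (head (n := 0) ?_ (refl ..))) (by omega)⟩
      rw [hc, Bool.false_and]
      simp [Program.step, evalProgram, Instr.exec]

theorem CNF.encode_eq (φ : CNF) :
    φ.encode = unary φ.vars ++ false :: (φ.clauses.flatMap encodeClause ++ [false]) := by
  simp only [CNF.encode, List.append_assoc, List.singleton_append]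
  rfl

theorem evalProgram_acceptsWithin_iff (φ : CNF) (b : Bool) (x : Fin φ.vars → Bool) {t : ℕ}
    (ht : 6 * φ.encode.length + 4 ≤ t) :
    evalProgram.AcceptsWithin O (true :: φ.encode) (b :: List.ofFn x) t ↔
      (b || φ.eval x) = true := by
  suffices ∃ a v, evalProgram.Reaches O t (start (true :: φ.encode) (b :: List.ofFn x))
      ⟨23, fourStacks ((b || φ.eval x) :: a) v [] []⟩ by
    obtain ⟨a, v, h⟩ := this
    rw [Program.AcceptsWithin, h.runFor_eq length_evalProgram.le]
    simp [length_evalProgram]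
  rw [start_eq_fourStacks]
  cases b
  · obtain ⟨a, ha⟩ := evalProgram_clauses O x φ.clauses
    refine ⟨a, List.ofFn x, mono (m := (φ.vars + 1) +
      (6 * (φ.clauses.flatMap encodeClause).length + 2) + 1 + 1) ?_ ?_⟩
    · refine head (by simp [Program.step, evalProgram, Instr.exec]; rfl) ?_
      refine head (d := ⟨2, fourStacks φ.encode (List.ofFn x) [] []⟩)
        (by simp [Program.step, evalProgram, Instr.exec]) ?_
      rw [CNF.encode_eq]
      exact trans (evalProgram_skip ..) ha
    · rw [CNF.encode_eq] at ht
      simp only [List.length_append, List.length_cons, List.length_nil, unary,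
        List.length_replicate] at ht
      omega
  · exact ⟨φ.encode, List.ofFn x, 3, by omega, by
      simp [Program.step, evalProgram, Instr.exec]⟩

end evalProgram

/-! ### The Walsh transform at zero and satisfiability -/

theorem dot_zeroPt {n : ℕ} (x : Fin n → Bool) : dot x (zeroPt n) = false := by
  simp [dot, zeroPt]

theorem abs_walsh_le {n : ℕ} (f : BoolFun n) (ω : Fin n → Bool) : |walsh f ω| ≤ 2 ^ n := by
  refine (Finset.abs_sum_le_sum_abs _ _).trans ?_
  simp [abs_pow]

/-- Pair `(1, x)` with `(0, x)`: the first contributes `-1`, the second `1` or `-1` according to `g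
x`. -/
theorem walsh_or_zeroPt {n : ℕ} (g : BoolFun n) :
    walsh (fun x : Fin (n + 1) → Bool => x 0 || g (Fin.tail x)) (zeroPt (n + 1)) =
      ∑ x : Fin n → Bool, if g x then -2 else 0 := by
  simp only [walsh, dot_zeroPt, Bool.xor_false]
  rw [← (Fin.consEquiv fun _ => Bool).sum_comp, Fintype.sum_prod_type, Fintype.sum_bool,
    ← Finset.sum_add_distrib]
  refine Finset.sum_congr rfl fun x _ => ?_
  simp only [Fin.consEquiv, Equiv.coe_fn_mk, Fin.cons_zero, Fin.tail_cons]
  cases g x <;> simp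

theorem walsh_or_zeroPt_neg_iff {n : ℕ} (g : BoolFun n) :
    walsh (fun x : Fin (n + 1) → Bool => x 0 || g (Fin.tail x)) (zeroPt (n + 1)) < 0 ↔
      ∃ x, g x = true := by
  rw [walsh_or_zeroPt, ← not_iff_not, not_lt]
  constructor
  · rintro h ⟨x, hx⟩
    refine h.not_gt (Finset.sum_neg' (fun y _ => ?_) ⟨x, Finset.mem_univ _, by simp [hx]⟩)
    split <;> simp
  · intro h
    refine Finset.sum_nonneg fun x _ => ?_
    rw [if_neg fun hx => h ⟨x, hx⟩]

/-- One sign bit and at most `n + 1` digits, since `2 ^ n` itself is allowed. -/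
theorem length_encodeInt_le {a : ℤ} {n : ℕ} (h : |a| ≤ 2 ^ n) : (encodeInt a).length ≤ n + 2 := by
  have : a.natAbs ≤ 2 ^ n := by zify; exact h
  rw [encodeInt, List.length_cons, Nat.size_eq_bits_len]
  exact Nat.succ_le_succ (Nat.size_le.2 (this.trans_lt (Nat.pow_lt_pow_succ (by norm_num))))

/-! ### The reduction -/

/-- This program puts `1` in front of its input, calls the oracle, and returns the first bit of the
answer. -/
def signProgram : Program :=
  [.push 0 true 1,
   .ask 0 2,
   .pop 0 3 4 3,
   .pop 0 3 3 5,
   .pop 0 4 4 6,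
   .push 0 false 7,
   .push 0 true 7]

/-- The sign is remembered in the address (`3` or `4`) while the rest of the answer is popped. -/
theorem signProgram_clear (O : List Bool → List Bool) (s : Bool) (l b c d : List Bool) :
    signProgram.Reaches O (l.length + 2) ⟨if s then 4 else 3, fourStacks l b c d⟩
      ⟨7, fourStacks [s] b c d⟩ := by
  induction l with
  | nil =>
    cases s <;> exact ⟨2, by simp, by simp [Program.step, signProgram, Instr.exec]⟩
  | cons a l ih =>
    cases s <;> cases a <;>
      exact (Program.Reaches.head (by simp [Program.step, signProgram, Instr.exec]) ih)

theorem signProgram_outputsWithin {O : List Bool → List Bool} {x l : List Bool} {s : Bool}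
    (h : O (true :: x) = s :: l) {t : ℕ} (ht : l.length + 5 ≤ t) :
    signProgram.OutputsWithin O x [] [s] t := by
  suffices signProgram.Reaches O t (start x []) ⟨7, fourStacks [s] [] [] []⟩ by
    rw [Program.OutputsWithin, this.runFor_eq le_rfl]
    exact ⟨le_rfl, rfl⟩
  rw [start_eq_fourStacks]
  refine Program.Reaches.mono (.trans (m := 3) ?_ (signProgram_clear O s l [] [] [])) (by omega)
  exact ⟨3, le_rfl, by cases s <;> simp [Program.step, signProgram, Instr.exec, h]⟩

theorem length_takeWhile_unary (n : ℕ) (r : List Bool) :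
    ((unary n ++ false :: r).takeWhile id).length = n := by
  induction n with
  | zero => simp [unary]
  | succ n ih => simp [unary, List.replicate_succ]

open Polynomial in
theorem turingReducible_sat_walsh_zero :
    TuringReducible CNF.encode CNF.Satisfiable (fun n f => walsh f (zeroPt n)) := by
  classical
  refine ⟨signProgram, X + 8, evalProgram, 6 * X + 4, fun φ => ?_⟩
  -- The extra `1` in front of the code raises the unary variable count by one, which makes room for
  -- the variable `x 0`.
  have hvars : ((true :: φ.encode).takeWhile id).length = φ.vars + 1 := by
    rw [CNF.encode_eq]
    exact length_takeWhile_unary (φ.vars + 1) _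
  -- The arity read off the query occurs in the type of `f` and equals `φ.vars + 1` only by a proof,
  -- so it is generalized to `m` before substitution.
  have key : ∀ m, m = φ.vars + 1 → ∃ f : BoolFun (φ.vars + 1),
      f = (fun x => x 0 || φ.eval (Fin.tail x)) ∧
      encodeInt (walsh (fun x : Fin m → Bool => decide (evalProgram.AcceptsWithin noOracle
        (true :: φ.encode) (List.ofFn x)
        ((6 * X + 4 : ℕ[X]).eval ((true :: φ.encode).length + m)))) (zeroPt m)) =
      encodeInt (walsh f (zeroPt (φ.vars + 1))) := by
    rintro _ rfl
    refine ⟨_, rfl, ?_⟩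
    congr 2
    funext x
    rw [List.ofFn_succ, Bool.eq_iff_iff, decide_eq_true_iff]
    exact evalProgram_acceptsWithin_iff _ φ _ _ (by simp; omega)
  obtain ⟨f, hf, h⟩ := key _ hvars
  have hneg := walsh_or_zeroPt_neg_iff φ.eval
  rw [← hf] at hneg
  have hs : decide φ.Satisfiable = decide (walsh f (zeroPt (φ.vars + 1)) < 0) := by
    rw [decide_eq_decide, hneg]; rfl
  rw [hs]
  refine signProgram_outputsWithin h ?_
  have h1 := length_encodeInt_le (abs_walsh_le f (zeroPt (φ.vars + 1)))
  have h2 : φ.vars + 1 ≤ φ.encode.length := by simp [CNF.encode_eq, unary]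
  simp only [encodeInt, List.length_cons] at h1
  simp
  omega

/-! ### Dependence of a computation on its oracle -/

theorem Program.step_congr {P : Program} {O O' : List Bool → List Bool} {c : Config}
    (h : ∀ s next, P[c.pc]? = some (.ask s next) → O (c.stack s) = O' (c.stack s)) :
    P.step O c = P.step O' c := by
  unfold Program.step
  rcases hi : P[c.pc]? with _ | (_ | _ | ⟨s, next⟩)
  · rfl
  · rfl
  · rfl
  · simp only [Instr.exec, h s next hi]

theorem Program.runFor_succ (P : Program) (O : List Bool → List Bool) (x y : List Bool) (t : ℕ) :
    P.runFor O x y (t + 1) = P.step O (P.runFor O x y t) :=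
  Function.iterate_succ_apply' ..

/-- The content of the stack that is queried by the next instruction (empty if there is no query). -/
def Program.query (P : Program) (c : Config) : List Bool :=
  match P[c.pc]? with
  | some (.ask s _) => c.stack s
  | _ => []

theorem Program.step_congr_query {P : Program} {O O' : List Bool → List Bool} {c : Config}
    (h : O (P.query c) = O' (P.query c)) : P.step O c = P.step O' c :=
  Program.step_congr fun s next hi => by simpa [Program.query, hi] using h

/-- A run of `t` steps depends on at most `t` values of the oracle. -/
theorem Program.exists_finset_runFor_eq (V : Program) (A : List Bool → Bool) (x y : List Bool)
    (t : ℕ) : ∃ T : Finset (List Bool), T.card ≤ t ∧ ∀ A', Set.EqOn A A' T →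
      V.runFor (boolOracle A') x y t = V.runFor (boolOracle A) x y t := by
  induction t with
  | zero => exact ⟨∅, by simp, fun _ _ => rfl⟩
  | succ t ih =>
    obtain ⟨T, hT, h⟩ := ih
    refine ⟨insert (V.query (V.runFor (boolOracle A) x y t)) T,
      (Finset.card_insert_le _ _).trans (by omega), fun A' hA => ?_⟩
    rw [Finset.coe_insert] at hA
    rw [Program.runFor_succ, Program.runFor_succ, h A' (hA.mono (Set.subset_insert _ _))]
    exact Program.step_congr_query (by rw [boolOracle, boolOracle, hA (Set.mem_insert _ _)])

/-- Answers have at most one bit, so stacks grow by at most one bit per step. This keeps queries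
short and hence bounds the verifier's running time on them. -/
theorem Program.length_stack_step_le {P : Program} {O : List Bool → List Bool}
    (hO : ∀ z, (O z).length ≤ 1) {c : Config} {n : ℕ} (h : ∀ s, (c.stack s).length ≤ n) (s : ℕ) :
    ((P.step O c).stack s).length ≤ n + 1 := by
  have key : ∀ (r : ℕ) (l : List Bool), l.length ≤ n + 1 →
      (Function.update c.stack r l s).length ≤ n + 1 := by
    intro r l hl
    rw [Function.update_apply]
    split
    · exact hl
    · exact (h s).trans (Nat.le_succ n)
  unfold Program.step
  rcases P[c.pc]? with _ | (⟨r, b, next⟩ | ⟨r, a, b, e⟩ | ⟨r, next⟩)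
  · exact (h s).trans (Nat.le_succ n)
  · exact key r _ (Nat.succ_le_succ (h r))
  · have hr := h r
    simp only [Instr.exec]
    split
    · exact (h s).trans (Nat.le_succ n)
    all_goals
      rename_i l hl
      rw [hl, List.length_cons] at hr
      exact key r l (by omega)
  · exact key r _ ((hO _).trans (by omega))

theorem Program.length_stack_runFor_le (P : Program) {O : List Bool → List Bool}
    (hO : ∀ z, (O z).length ≤ 1) (x : List Bool) (t s : ℕ) :
    ((P.runFor O x [] t).stack s).length ≤ x.length + t := by
  induction t generalizing s with
  | zero =>
    simp only [Program.runFor, Function.iterate_zero, id, start]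
    split_ifs <;> simp
  | succ t ih =>
    rw [Program.runFor_succ]
    exact Program.length_stack_step_le hO ih s

theorem Program.length_query_runFor_le (P : Program) {O : List Bool → List Bool}
    (hO : ∀ z, (O z).length ≤ 1) (x : List Bool) (t : ℕ) :
    (P.query (P.runFor O x [] t)).length ≤ x.length + t := by
  unfold Program.query
  split
  · exact P.length_stack_runFor_le hO x t _
  · simp

theorem eval_mono_nat (p : Polynomial ℕ) : Monotone fun n => p.eval n := fun a b h => by
  simp only [Polynomial.eval_eq_sum, Polynomial.sum]
  gcongr

/-- Membership in an `NP` language is decided by few values of the oracle. -/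
theorem exists_finset_mem_npLang {V : Program} {p : Polynomial ℕ} {A : List Bool → Bool}
    {q : List Bool} (hq : q ∈ npLang V p A) : ∃ T : Finset (List Bool),
      T.card ≤ p.eval q.length ∧ ∀ A', Set.EqOn A A' T → q ∈ npLang V p A' := by
  obtain ⟨y, hy, hacc⟩ := hq
  obtain ⟨T, hT, h⟩ := V.exists_finset_runFor_eq A q y (p.eval q.length)
  refine ⟨T, hT, fun A' hA => ⟨y, hy, ?_⟩⟩
  rw [Program.AcceptsWithin, h A' hA]
  exact hacc

theorem langOracle_congr {L L' : Set (List Bool)} {q : List Bool} (h : q ∈ L ↔ q ∈ L') :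
    langOracle L q = langOracle L' q := by
  simp [langOracle, h]

theorem length_langOracle_le (L : Set (List Bool)) (z : List Bool) :
    (langOracle L z).length ≤ 1 := le_rfl

/-- The configuration of a `P^NP` algorithm on the input `x` after `t` steps. -/
noncomputable def PNPAlgorithm.runFor (P : PNPAlgorithm) (A : List Bool → Bool) (x : List Bool)
    (t : ℕ) : Config :=
  P.machine.runFor (langOracle (npLang P.verifier P.bound A)) x [] t

/-- Few values of the oracle, chosen by an adversary that makes a query true whenever it still can,
determine the run of a `P^NP` algorithm. -/
theorem PNPAlgorithm.exists_forced_run (P : PNPAlgorithm) (x : List Bool) (S : Set (List Bool))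
    (A₀ : List Bool → Bool) {N t : ℕ} (ht : t ≤ N) :
    ∃ (A₁ : List Bool → Bool) (T : Finset (List Bool)),
      T.card ≤ t * P.bound.eval (x.length + N) ∧ Set.EqOn A₀ A₁ S ∧
      ∀ A, Set.EqOn A₁ A (S ∪ T) → P.runFor A x t = P.runFor A₁ x t := by
  classical
  induction t with
  | zero => exact ⟨A₀, ∅, by simp, fun _ _ => rfl, fun _ _ => rfl⟩
  | succ t ih =>
    obtain ⟨A₁, T, hT, hS, h⟩ := ih (by omega)
    set q := P.machine.query (P.runFor A₁ x t) with hq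
    have step : ∀ A, P.runFor A x t = P.runFor A₁ x t → ∀ A', P.runFor A' x t = P.runFor A₁ x t →
        (q ∈ npLang P.verifier P.bound A ↔ q ∈ npLang P.verifier P.bound A') →
        P.runFor A x (t + 1) = P.runFor A' x (t + 1) := by
      intro A hA A' hA' hqq
      simp only [PNPAlgorithm.runFor, Program.runFor_succ] at hA hA' ⊢
      rw [hA, hA']
      exact Program.step_congr_query (langOracle_congr hqq)
    -- The adversary's choice: adopt a consistent oracle that makes `q` true and fix what one
    -- accepting run reads, or, if there is none, keep `A₁` and fix nothing.
    by_cases hyes : ∃ A, Set.EqOn A₁ A (S ∪ T) ∧ q ∈ npLang P.verifier P.bound A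
    · obtain ⟨A₂, hA₂, hmem⟩ := hyes
      obtain ⟨T', hT', h'⟩ := exists_finset_mem_npLang hmem
      refine ⟨A₂, T ∪ T', ?_, hS.trans (hA₂.mono Set.subset_union_left), fun A hA => ?_⟩
      · have hlen : q.length ≤ x.length + N :=
          (P.machine.length_query_runFor_le (length_langOracle_le _) x t).trans (by omega)
        calc (T ∪ T').card ≤ T.card + T'.card := Finset.card_union_le _ _
          _ ≤ t * P.bound.eval (x.length + N) + P.bound.eval (x.length + N) :=
            Nat.add_le_add hT (hT'.trans (eval_mono_nat _ hlen))
          _ = _ := by ring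
      · rw [Finset.coe_union, ← Set.union_assoc] at hA
        refine step A (h A (hA₂.trans (hA.mono Set.subset_union_left))) A₂ (h A₂ hA₂) ?_
        exact iff_of_true (h' A (hA.mono Set.subset_union_right)) hmem
    · push Not at hyes
      refine ⟨A₁, T, hT.trans (Nat.mul_le_mul_right _ (Nat.le_succ t)), hS, fun A hA => ?_⟩
      exact step A (h A hA) A₁ rfl (iff_of_false (hyes A hA) (hyes A₁ (Set.eqOn_refl _ _)))

theorem PNPAlgorithm.computes_congr {P : PNPAlgorithm} {A A' : List Bool → Bool} {x : List Bool}
    (h : P.runFor A x (P.time.eval x.length) = P.runFor A' x (P.time.eval x.length))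
    (w : List Bool) : P.Computes A x w ↔ P.Computes A' x w := by
  simp only [PNPAlgorithm.runFor] at h
  simp only [PNPAlgorithm.Computes, Program.OutputsWithin, h]

theorem PNPAlgorithm.Computes.unique {P : PNPAlgorithm} {A : List Bool → Bool} {x v w : List Bool}
    (hv : P.Computes A x v) (hw : P.Computes A x w) : v = w :=
  hv.2.symm.trans hw.2

/-! ### The Walsh transform as output -/

theorem bits_injective : Function.Injective Nat.bits := by
  intro a
  induction a using Nat.binaryRec' with
  | zero =>
    intro b h
    rw [Nat.zero_bits] at h
    have := Nat.size_eq_bits_len b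
    rw [← h] at this
    exact (Nat.size_eq_zero.1 this.symm).symm
  | bit c m hm ih =>
    intro b h
    induction b using Nat.binaryRec' with
    | zero => simp [Nat.bits_append_bit m c hm] at h
    | bit d k hk _ =>
      rw [Nat.bits_append_bit m c hm, Nat.bits_append_bit k d hk, List.cons.injEq] at h
      rw [h.1, ih h.2]

theorem encodeInt_injective : Function.Injective encodeInt := by
  intro a b h
  simp only [encodeInt, List.cons.injEq, decide_eq_decide] at h
  have := bits_injective h.2
  omega

/-- Only the term at `x` changes, and it changes sign. -/
theorem walsh_update_ne {n : ℕ} (f : BoolFun n) (ω x : Fin n → Bool) :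
    walsh (Function.update f x (!f x)) ω ≠ walsh f ω := by
  rw [← sub_ne_zero, walsh, walsh, ← Finset.sum_sub_distrib, Finset.sum_eq_single x]
  · rw [Function.update_self]
    cases f x <;> cases dot x ω <;> decide
  · intro y _ hy
    rw [Function.update_of_ne hy, sub_self]
  · simp

theorem slice_update {A : List Bool → Bool} {n : ℕ} (x : Fin n → Bool) (b : Bool) :
    slice (Function.update A (List.ofFn x) b) n = Function.update (slice A n) x b := by
  funext y
  simp only [slice, Function.update_apply, List.ofFn_inj]

theorem slice_congr {A A' : List Bool → Bool} {n : ℕ} (h : Set.EqOn A A' {z | z.length = n}) :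
    slice A n = slice A' n :=
  funext fun x => h (List.length_ofFn (f := x))

/-- Prescribing `0` at all other lengths turns a general oracle into a black box. -/
theorem blackBox_slice {A : List Bool → Bool} {n : ℕ}
    (h : Set.EqOn (fun _ => false) A {z | z.length ≠ n}) : blackBox (slice A n) = A := by
  funext z
  by_cases hz : z.length = n
  · subst hz
    simp [blackBox, slice]
  · simp only [blackBox, hz, dif_neg, not_false_iff]
    exact h hz

theorem exists_ofFn_notMem {n : ℕ} {T : Finset (List Bool)} (hT : T.card < 2 ^ n) :
    ∃ x : Fin n → Bool, List.ofFn x ∉ T := by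
  classical
  by_contra! h
  have : (Finset.univ.image (List.ofFn : (Fin n → Bool) → List Bool)).card ≤ T.card :=
    Finset.card_le_card fun z hz => by
      obtain ⟨x, -, rfl⟩ := Finset.mem_image.1 hz
      exact h x
  rw [Finset.card_image_of_injective _ List.ofFn_injective] at this
  simp at this
  omega

open Polynomial in
/-- A bound on the number of oracle values that determine the run of the algorithm. -/
noncomputable def PNPAlgorithm.cost (P : PNPAlgorithm) : ℕ[X] :=
  P.time * P.bound.comp (X + P.time)

/-- An oracle whose values on `{0,1}ⁿ` are not prescribed can be chosen such that the algorithm fails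
to compute its Walsh transform, and this is ensured by finitely many of the free values. -/
theorem PNPAlgorithm.exists_fails (P : PNPAlgorithm) {n : ℕ} (hn : P.cost.eval n < 2 ^ n)
    (ω : Fin n → Bool) {x : List Bool} (hx : x.length = n) {S : Set (List Bool)}
    (hS : ∀ z ∈ S, z.length ≠ n) (A₀ : List Bool → Bool) :
    ∃ (A₁ : List Bool → Bool) (T : Finset (List Bool)), Set.EqOn A₀ A₁ S ∧
      ∀ A, Set.EqOn A₁ A (S ∪ T) → ¬ P.Computes A x (encodeInt (walsh (slice A n) ω)) := by
  classical
  obtain ⟨A₁, T, hT, hA₁, h⟩ := P.exists_forced_run x S A₀ (le_refl (P.time.eval x.length))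
  obtain ⟨u, hu⟩ : ∃ u : Fin n → Bool, List.ofFn u ∉ T := by
    refine exists_ofFn_notMem (hT.trans_lt ?_)
    simpa [PNPAlgorithm.cost, hx] using hn
  -- The oracle `A₁` and its flip at `u` lead to the same output but have different Walsh values, so
  -- the output is wrong for one of them; `u` is free because `S` contains no string of length `n`.
  obtain ⟨A₂, hA₂, hfail⟩ : ∃ A₂, Set.EqOn A₁ A₂ (S ∪ T) ∧
      ¬ P.Computes A₁ x (encodeInt (walsh (slice A₂ n) ω)) := by
    by_contra! hall
    refine walsh_update_ne (slice A₁ n) ω u ?_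
    rw [← slice_update]
    refine encodeInt_injective ((hall _ fun z hz => ?_).unique (hall A₁ (Set.eqOn_refl _ _)))
    refine (Function.update_of_ne ?_ _ _).symm
    rintro rfl
    exact hz.elim (fun hz => hS _ hz List.length_ofFn) hu
  -- All of `{0,1}ⁿ` is fixed as well, so that the Walsh value, and not only the output, is
  -- determined.
  refine ⟨A₂, T ∪ Finset.univ.image (List.ofFn : (Fin n → Bool) → List Bool),
    hA₁.trans (hA₂.mono Set.subset_union_left), fun A hA => ?_⟩
  rw [Finset.coe_union, ← Set.union_assoc] at hA
  rw [P.computes_congr (h A (hA₂.trans (hA.mono Set.subset_union_left))),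
    slice_congr (n := n) (A := A) (A' := A₂)]
  · exact hfail
  · intro z hz
    refine (hA (Or.inr ?_)).symm
    obtain rfl : z.length = n := hz
    simpa using ⟨z.get, List.ofFn_get z⟩

open Filter Polynomial in
theorem eventually_eval_lt_two_pow (Q : ℕ[X]) : ∀ᶠ n : ℕ in atTop, Q.eval n < 2 ^ n := by
  have h : (fun n : ℕ => ((Q.eval n : ℕ) : ℝ)) =o[atTop] fun n => (2 : ℝ) ^ n := by
    induction Q using Polynomial.induction_on' with
    | add p q hp hq => simpa using hp.add hq
    | monomial k a =>
      simpa using (isLittleO_pow_const_const_pow_of_one_lt (R := ℝ) k one_lt_two).const_mul_left a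
  filter_upwards [h.def (c := 1 / 2) (by norm_num)] with n hn
  rw [Real.norm_of_nonneg (by positivity), Real.norm_of_nonneg (by positivity)] at hn
  have h2 : (0 : ℝ) < 2 ^ n := by positivity
  exact_mod_cast (show ((Q.eval n : ℕ) : ℝ) < 2 ^ n by linarith)

/-! ### Diagonalization -/

/-- The data of an instruction. -/
def Instr.toSum : Instr → (ℕ × Bool × ℕ) ⊕ (ℕ × ℕ × ℕ × ℕ) ⊕ (ℕ × ℕ)
  | .push s b next => .inl (s, b, next)
  | .pop s onFalse onTrue onEmpty => .inr (.inl (s, onFalse, onTrue, onEmpty))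
  | .ask s next => .inr (.inr (s, next))

instance : Countable Instr :=
  Function.Injective.countable (f := Instr.toSum) (by
    rintro (_ | _ | _) (_ | _ | _) h <;> simp_all [Instr.toSum])

instance : Countable (Polynomial ℕ) :=
  Cardinal.mk_le_aleph0_iff.1 (Polynomial.cardinalMk_le_max.trans (by simp))

instance : Countable PNPAlgorithm :=
  Function.Injective.countable
    (f := fun P : PNPAlgorithm => (P.machine, P.time, P.verifier, P.bound)) (by
      rintro ⟨_, _, _, _⟩ ⟨_, _, _, _⟩ h
      simp_all)

/-- Fixing finitely many values is a cylinder condition in the product topology on oracles. -/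
theorem isOpen_setOf_eqOn (A : List Bool → Bool) (T : Finset (List Bool)) :
    IsOpen {A' : List Bool → Bool | Set.EqOn A A' T} := by
  have : {A' : List Bool → Bool | Set.EqOn A A' T} = (T : Set (List Bool)).pi fun z => {A z} := by
    ext A'
    simp [Set.EqOn, eq_comm]
  rw [this]
  exact isOpen_set_pi T.finite_toSet fun _ _ => isOpen_discrete _

/-- Countably many requirements, each of which can be met by fixing finitely many further values of
an oracle, can be met simultaneously. -/
theorem exists_oracle_forall {ι : Type*} [Countable ι] (F : ι → (List Bool → Bool) → Prop)
    (hF : ∀ i (S : Finset (List Bool)) A₀, ∃ (A₁ : List Bool → Bool) (T : Finset (List Bool)),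
      Set.EqOn A₀ A₁ S ∧ ∀ A, Set.EqOn A₁ A T → F i A) : ∃ A, ∀ i, F i A := by
  -- Baire category on the space of oracles: `hF` says that the interior of each requirement meets
  -- every basic open set.
  have hdense : Dense (⋂ i, interior {A | F i A}) := by
    refine dense_iInter_of_isOpen (fun _ => isOpen_interior) fun i => ?_
    rw [dense_iff_inter_open]
    rintro U hU ⟨A₀, hA₀⟩
    obtain ⟨S, u, hu, hSU⟩ := isOpen_pi_iff.1 hU A₀ hA₀
    obtain ⟨A₁, T, hA₁, h⟩ := hF i S A₀
    refine ⟨A₁, hSU fun z hz => ?_, mem_interior.2 ⟨_, h, isOpen_setOf_eqOn A₁ T, fun _ _ => rfl⟩⟩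
    rw [← hA₁ hz]
    exact (hu z hz).2
  obtain ⟨A, hA⟩ := hdense.nonempty
  exact ⟨A, fun i => interior_subset (Set.mem_iInter.1 hA i)⟩

section outside
variable (ω : (n : ℕ) → Fin n → Bool) (x : ℕ → List Bool) (hx : ∀ n, (x n).length = n)
include hx

/-- The input `x n` matters only through its length, so `unary n` and the code of `ω n` are treated
together. -/
theorem not_exists_computes_walsh_blackBox :
    ¬ ∃ P : PNPAlgorithm, ∀ n : ℕ, 1 ≤ n → ∀ f : BoolFun n,
      P.Computes (blackBox f) (x n) (encodeInt (walsh f (ω n))) := by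
  rintro ⟨P, hP⟩
  obtain ⟨n, hn, hn1⟩ :=
    ((eventually_eval_lt_two_pow P.cost).and (Filter.eventually_ge_atTop 1)).exists
  -- Here the prescribed set `S` is infinite: every string of length other than `n` gets the value
  -- `0`.
  obtain ⟨A, T, hA, h⟩ := P.exists_fails hn (ω n) (hx n) (S := {z | z.length ≠ n})
    (fun _ hz => hz) (fun _ => false)
  refine h A (Set.eqOn_refl _ _) ?_
  simpa only [blackBox_slice hA] using hP n hn1 (slice A n)

theorem exists_oracle_not_exists_computes_walsh :
    ∃ A : List Bool → Bool, ¬ ∃ P : PNPAlgorithm, ∀ n : ℕ, 1 ≤ n →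
      P.Computes A (x n) (encodeInt (walsh (slice A n) (ω n))) := by
  obtain ⟨A, hA⟩ := exists_oracle_forall
    (fun (P : PNPAlgorithm) A => ∃ n, 1 ≤ n ∧
      ¬ P.Computes A (x n) (encodeInt (walsh (slice A n) (ω n)))) fun P S A₀ => by
    classical
    -- With `n` beyond all lengths in `S`, the earlier prescriptions leave `{0,1}ⁿ` untouched.
    obtain ⟨n, ⟨hn, hn1⟩, hS⟩ := (((eventually_eval_lt_two_pow P.cost).and
      (Filter.eventually_ge_atTop 1)).and (Filter.eventually_gt_atTop (S.sup List.length))).exists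
    obtain ⟨A₁, T, hA₁, h⟩ := P.exists_fails hn (ω n) (hx n) (S := S)
      (fun z hz => ((Finset.le_sup (f := List.length) hz).trans_lt hS).ne) A₀
    exact ⟨A₁, S ∪ T, hA₁, fun A hA => ⟨n, hn1, h A (by simpa using hA)⟩⟩
  refine ⟨A, ?_⟩
  rintro ⟨P, hP⟩
  obtain ⟨n, hn1, h⟩ := hA P
  exact h (hP n hn1)

end outside

end WalshOracle

theorem proposition1 :
    -- SAT is polynomial-time Turing reducible to computing `W_f(0)`
    TuringReducible CNF.encode CNF.Satisfiable (fun n f => walsh f (zeroPt n)) ∧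
    -- computing `W_f(0)` from `n` and the oracle `f` is outside `P^NP`
    ((¬ ∃ P : PNPAlgorithm, ∀ (n : ℕ) (f : BoolFun n),
        P.Computes (blackBox f) (unary n) (encodeInt (walsh f (zeroPt n)))) ∧
      ∃ A : List Bool → Bool, ¬ ∃ P : PNPAlgorithm, ∀ n : ℕ,
        P.Computes A (unary n) (encodeInt (walsh (slice A n) (zeroPt n)))) ∧
    -- computing `W_f(ω)` from a given nonzero `ω` and the oracle `f` is outside `P^NP`
    (∀ ω : (n : ℕ) → Fin n → Bool, (∀ n, 1 ≤ n → ω n ≠ zeroPt n) →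
      (¬ ∃ P : PNPAlgorithm, ∀ n : ℕ, 1 ≤ n → ∀ f : BoolFun n,
        P.Computes (blackBox f) (List.ofFn (ω n)) (encodeInt (walsh f (ω n)))) ∧
      ∃ A : List Bool → Bool, ¬ ∃ P : PNPAlgorithm, ∀ n : ℕ, 1 ≤ n →
        P.Computes A (List.ofFn (ω n)) (encodeInt (walsh (slice A n) (ω n)))) := by
  refine ⟨turingReducible_sat_walsh_zero, ⟨?_, ?_⟩, fun ω _ => ⟨?_, ?_⟩⟩
  · rintro ⟨P, hP⟩
    exact not_exists_computes_walsh_blackBox zeroPt unary (fun _ => List.length_replicate)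
      ⟨P, fun n _ => hP n⟩
  · obtain ⟨A, hA⟩ := exists_oracle_not_exists_computes_walsh zeroPt unary
      fun _ => List.length_replicate
    exact ⟨A, fun ⟨P, hP⟩ => hA ⟨P, fun n _ => hP n⟩⟩
  · exact not_exists_computes_walsh_blackBox ω (fun n => List.ofFn (ω n)) fun _ => List.length_ofFn
  · exact exists_oracle_not_exists_computes_walsh ω (fun n => List.ofFn (ω n))
      fun _ => List.length_ofFn
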